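/- Let $2 \le p < \infty$ and $s > \frac{p-2}{p-1}$ be real numbers. Let $C \subset \mathbb{R}$ be a closed set with $\mathcal{H}^s(C) > 0$, and let \[ F = [0,1] \setminus \bigcup_{j=1}^\infty I_j , \] where $I_1, I_2, \dots \subset \mathbb{R}$ are (possibly empty, not necessarily disjoint) bounded open intervals, with lengths $|I_j|$, such that \[ \sum_{j=1}^\infty |I_j|^{1-(1-s)(p-1)} < \infty , \] and suppose that $\mathcal{H}^1(F) > 0$. Here $\mathcal{H}^t$ denotes the $t$-dimensional Hausdorff measure. Then the set $C \times F \subset \mathbb{R}^2$ is not removable for $W^{1,p}$. Here, for an open set $\Omega \subset \mathbb{R}^2$, $W^{1,p}(\Omega)$ is the set of real-valued functions in $L^p(\Omega)$ whose weak first order partial derivatives exist and belong to $L^p(\Omega)$, and a closed set $E \subset \mathbb{R}^2$ is called removable for $W^{1,p}$ if $E$ has Lebesgue measure zero and $W^{1,p}(\mathbb{R}^2 \setminus E) = W^{1,p}(\mathbb{R}^2)$ as sets, that is, every function in $W^{1,p}(\mathbb{R}^2 \setminus E)$ belongs, after being extended arbitrarily to the null set $E$, to $W^{1,p}(\mathbb{R}^2)$.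 (In particular, a set of positive Lebesgue measure is not removable.) -/

import Mathlib

open MeasureTheory Set

/-- `g` is a weak derivative of `u` in the direction `e` on the open set `Ω ⊆ ℝ²`: both are locally
integrable on `Ω` and `∫_Ω u ∂_e φ = - ∫_Ω g φ` for all smooth `φ` with compact support in `Ω`. -/
def HasWeakPartialDeriv (Ω : Set (ℝ × ℝ)) (e : ℝ × ℝ) (u g : ℝ × ℝ → ℝ) : Prop :=
  LocallyIntegrableOn u Ω volume ∧ LocallyIntegrableOn g Ω volume ∧
    ∀ φ : ℝ × ℝ → ℝ, ContDiff ℝ (⊤ : ℕ∞) φ → HasCompactSupport φ → tsupport φ ⊆ Ω →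
      ∫ z in Ω, u z * fderiv ℝ φ z e = - ∫ z in Ω, g z * φ z

/-- The Sobolev space `W^{1,p}(Ω)` of an open set `Ω ⊆ ℝ²`. Its elements are written as functions
on `ℝ²`; their values outside `Ω` play no role. -/
def sobolevW1 (Ω : Set (ℝ × ℝ)) (p : ENNReal) : Set (ℝ × ℝ → ℝ) :=
  {u | MemLp u p (volume.restrict Ω) ∧
    (∃ g : ℝ × ℝ → ℝ, MemLp g p (volume.restrict Ω) ∧ HasWeakPartialDeriv Ω (1, 0) u g) ∧
    (∃ g : ℝ × ℝ → ℝ, MemLp g p (volume.restrict Ω) ∧ HasWeakPartialDeriv Ω (0, 1) u g)}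

/-- `E ⊆ ℝ²` is removable for `W^{1,p}`: it has Lebesgue measure zero and
`W^{1,p}(ℝ² ∖ E) = W^{1,p}(ℝ²)` as sets. Since `E` is a null set, a function on `ℝ²` and its
restriction to `ℝ² ∖ E` determine each other up to equality almost everywhere. -/
def IsSobolevRemovable (p : ENNReal) (E : Set (ℝ × ℝ)) : Prop :=
  volume E = 0 ∧ sobolevW1 Eᶜ p = sobolevW1 univ p

/-!
`C × F` is not removable because a Cantor function carried by `C` can be continued from the lines
`ℝ × {y}`, `y ∈ F`, to a function that is Sobolev off `C × F`, while on these lines it keeps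
variation that no weak derivative can account for.

The Cantor function `f` is the distribution function of a Hausdorff content of a bounded piece
of `C` (`exists_holder_cantor_function`). It is monotone, nonconstant, locally constant off `C`, and
satisfies `f y - f x ≤ A (y - x) ^ s`; no Frostman measure is needed on the line.

At height `y` let `d` be comparable to the distance from `y` to `F`, and replace `f` by its means
over the windows `[x, x + d]` (`gapMean`). The distance is replaced by `gapDist`, a quadratic
polynomial on each gap of `F`, so that the result is `C¹` off `C × F`: near `(x, y)` with `y ∈ F`
and `x ∉ C` the windows are short and `f` is constant on them. By monotonicity, both partial derivatives
are bounded by the mean slope `q = (f (x + d) - f x) / d`. Hölder continuity gives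
`q ^ p ≤ (A d ^ (s - 1)) ^ (p - 1) q`, and `q` has bounded integral over a horizontal line, so
`∫ q ^ p dx` is at most a constant times `d ^ (α - 1)` with `α = 1 - (1 - s) (p - 1) > 0`. Each
interval of length `ℓ` that avoids `F` then contributes at most a constant times `ℓ ^ α`
(`lintegral_meanSlope_gapDist_lt_top`). After a smooth cutoff the function is therefore in
`W^{1,p}(ℝ² ∖ (C × F))` (`mul_gapMean_mem_sobolevW1`).

If `C × F` were removable, then `C` would be a null set, since `F` has positive measure, and the
weak derivative in the horizontal direction on the plane would agree almost everywhere with the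
classical one, which vanishes at `(x, y)` for `y ∈ F`, `x ∉ C` where the cutoff is `1`. Restricted
to almost every line at a height in `F` (`HasWeakPartialDeriv.ae_integral_line_eq_zero`), this says
that `∫ f φ' = 0` for a test function `φ` equal to `1` on an interval outside which `f` is `0` on
the left and `M > 0` on the right; but that integral is `-M`.
-/

/-! ### A Cantor function carried by a set of positive Hausdorff measure -/

theorem exists_pos_hausdorffMeasure_inter_Icc {s : ℝ} {C : Set ℝ}
    (hC : 0 < Measure.hausdorffMeasure s C) :
    ∃ n : ℕ, 0 < Measure.hausdorffMeasure s (C ∩ Icc (-(n : ℝ)) n) := by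
  by_contra! h
  have hcov : C ⊆ ⋃ n : ℕ, C ∩ Icc (-(n : ℝ)) n := fun x hx => by
    obtain ⟨n, hn⟩ := exists_nat_ge |x|
    exact mem_iUnion.2 ⟨n, hx, abs_le.1 hn⟩
  exact hC.ne' (measure_mono_null hcov (measure_iUnion_null fun n => le_antisymm (h n) bot_le))

theorem le_one_of_pos_hausdorffMeasure_real {s : ℝ} {C : Set ℝ}
    (hC : 0 < Measure.hausdorffMeasure s C) : s ≤ 1 := by
  by_contra! hs
  obtain ⟨n, hn⟩ := exists_pos_hausdorffMeasure_inter_Icc hC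
  rcases Measure.hausdorffMeasure_zero_or_top hs (C ∩ Icc (-(n : ℝ)) n) with h | h
  · exact hn.ne' h
  · rw [hausdorffMeasure_real] at h
    exact (measure_mono_top inter_subset_right h).not_lt (by simp)

/-- A set of positive `s`-dimensional Hausdorff measure has positive `s`-dimensional Hausdorff
content at some scale `r`: the outer measure `mkMetric'.pre` is the infimum of `∑ diam ^ s` over
countable covers by sets of diameter at most `r`. -/
theorem exists_hausdorffContent_pos {s : ℝ} {K : Set ℝ}
    (hK : 0 < Measure.hausdorffMeasure s K) :
    ∃ r : ℝ, 0 < r ∧ 0 < OuterMeasure.mkMetric'.pre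
      (fun t : Set ℝ => Metric.ediam t ^ s) (ENNReal.ofReal r) K := by
  by_contra! h
  refine hK.ne' ?_
  have : Measure.hausdorffMeasure s K
      = (OuterMeasure.mkMetric' (fun t : Set ℝ => Metric.ediam t ^ s)) K := by
    rw [Measure.hausdorffMeasure, ← Measure.coe_toOuterMeasure, Measure.mkMetric_toOuterMeasure]
    rfl
  rw [this, OuterMeasure.mkMetric'.eq_iSup_nat, OuterMeasure.iSup_apply]
  refine ENNReal.iSup_eq_zero.2 fun n => ?_
  refine le_antisymm (le_trans (OuterMeasure.mkMetric'.mono_pre _ ?_ K)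
    (h (((n : ℝ) + 1)⁻¹) (by positivity))) bot_le
  rw [ENNReal.ofReal_inv_of_pos (by positivity), ENNReal.inv_le_inv,
    ENNReal.ofReal_add (by positivity) zero_le_one]
  simp

/-- A Hölder continuous Cantor function. In dimension one, the distribution function
`x ↦ content (C ∩ [-n, n] ∩ (-∞, x])` of a Hausdorff content replaces the distribution function of
a Frostman measure: subadditivity of the content gives both the Hölder bound and the constancy on
intervals that avoid `C`. -/
theorem exists_holder_cantor_function {s : ℝ} (hs : 0 < s) {C : Set ℝ} (hCc : IsClosed C)
    (hC : 0 < Measure.hausdorffMeasure s C) :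
    ∃ (f : ℝ → ℝ) (R M A : ℝ), 0 ≤ R ∧ 0 < M ∧ 0 ≤ A ∧ Monotone f ∧
      (∀ x < -R, f x = 0) ∧ (∀ x, R ≤ x → f x = M) ∧
      (∀ x y, x ≤ y → f y - f x ≤ A * (y - x) ^ s) ∧
      (∀ x ∉ C, ∃ ε > 0, ∀ y, |y - x| < ε → f y = f x) := by
  obtain ⟨n, hn⟩ := exists_pos_hausdorffMeasure_inter_Icc hC
  obtain ⟨r, hr, hpos⟩ := exists_hausdorffContent_pos hn
  set K := C ∩ Icc (-(n : ℝ)) n with hKdef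
  set c := OuterMeasure.mkMetric'.pre (fun t : Set ℝ => Metric.ediam t ^ s) (ENNReal.ofReal r)
    with hc
  have hIcc : ∀ x y : ℝ, x ≤ y → y - x ≤ r → c (Icc x y) ≤ ENNReal.ofReal ((y - x) ^ s) := by
    intro x y hxy hyr
    refine (OuterMeasure.mkMetric'.pre_le ?_).trans ?_
    · rw [Real.ediam_Icc]; exact ENNReal.ofReal_le_ofReal hyr
    · rw [Real.ediam_Icc, ENNReal.ofReal_rpow_of_nonneg (by linarith) hs.le]
  have hfin : c K ≠ ⊤ := by
    obtain ⟨N, hN⟩ := exists_nat_ge ((2 * n : ℝ) / r)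
    have hcov : K ⊆ ⋃ k ∈ Finset.range (N + 1), Icc (-(n : ℝ) + k * r) (-(n : ℝ) + k * r + r) := by
      intro x hx
      have hx1 : 0 ≤ (x + n) / r := div_nonneg (by linarith [hx.2.1]) hr.le
      refine mem_iUnion₂.2 ⟨⌊(x + n) / r⌋₊, ?_, ?_, ?_⟩
      · rw [Finset.mem_range, Nat.lt_succ_iff]
        refine Nat.floor_le_of_le (le_trans ?_ hN)
        gcongr; linarith [hx.2.2]
      · have := Nat.floor_le hx1
        rw [le_div_iff₀ hr] at this
        linarith
      · have := (Nat.lt_floor_add_one ((x + n) / r)).le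
        rw [div_le_iff₀ hr] at this
        linarith
    refine ne_top_of_le_ne_top ?_ ((measure_mono hcov).trans (measure_biUnion_finset_le _ _))
    refine ENNReal.sum_ne_top.2 fun k _ => ne_top_of_le_ne_top ENNReal.ofReal_ne_top
      (hIcc _ _ (by linarith) (by linarith))
  have hfin' : ∀ x, c (K ∩ Iic x) ≠ ⊤ := fun x =>
    ne_top_of_le_ne_top hfin (measure_mono inter_subset_left)
  have hmono : Monotone fun x => (c (K ∩ Iic x)).toReal := fun x y hxy =>
    ENNReal.toReal_mono (hfin' y) (measure_mono (inter_subset_inter_right _ (Iic_subset_Iic.2 hxy)))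
  have htop : ∀ x, (n : ℝ) ≤ x → K ∩ Iic x = K := fun x hx =>
    inter_eq_left.2 fun z hz => hz.2.2.trans hx
  have hsub : ∀ x y, x ≤ y →
      c (K ∩ Iic y) ≤ c (K ∩ Iic x) + c (K ∩ Icc x y) := by
    intro x y hxy
    refine (measure_mono ?_).trans (measure_union_le _ _)
    rintro z ⟨hz, hzy⟩
    rcases le_total z x with h | h
    · exact Or.inl ⟨hz, h⟩
    · exact Or.inr ⟨hz, h, hzy⟩
  have hconst : ∀ x y, x ≤ y → K ∩ Icc x y = ∅ →
      (c (K ∩ Iic y)).toReal = (c (K ∩ Iic x)).toReal := by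
    intro x y hxy h
    refine le_antisymm (ENNReal.toReal_mono (hfin' x) ?_) (hmono hxy)
    simpa [h] using hsub x y hxy
  refine ⟨fun x => (c (K ∩ Iic x)).toReal, n, (c K).toReal, max 1 ((c K).toReal * (r ^ s)⁻¹),
    Nat.cast_nonneg n, ENNReal.toReal_pos hpos.ne' hfin, le_max_of_le_left zero_le_one, hmono,
    ?_, ?_, ?_, ?_⟩
  · intro x hx
    have : K ∩ Iic x = ∅ := by
      refine eq_empty_of_forall_notMem fun z hz => ?_
      have := hz.1.2.1
      have := mem_Iic.1 hz.2
      linarith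
    simp [this]
  · intro x hx
    simp only [htop x hx]
  · intro x y hxy
    have h0 : 0 ≤ (y - x) ^ s := Real.rpow_nonneg (by linarith) _
    rcases le_total (y - x) r with h | h
    · have h1 : (c (K ∩ Iic y)).toReal ≤ (c (K ∩ Iic x)).toReal + (y - x) ^ s := by
        rw [← ENNReal.toReal_ofReal h0, ← ENNReal.toReal_add (hfin' x) ENNReal.ofReal_ne_top]
        refine ENNReal.toReal_mono (ENNReal.add_ne_top.2 ⟨hfin' x, ENNReal.ofReal_ne_top⟩)
          ((hsub x y hxy).trans ?_)
        gcongr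
        exact (measure_mono inter_subset_right).trans (hIcc x y hxy h)
      have := mul_le_mul_of_nonneg_right (le_max_left 1 ((c K).toReal * (r ^ s)⁻¹)) h0
      dsimp only
      linarith
    · -- at scales above `r` the total variation of `f` is enough
      have h1 : (c (K ∩ Iic y)).toReal ≤ (c K).toReal :=
        ENNReal.toReal_mono hfin (measure_mono inter_subset_left)
      have h2 : (0 : ℝ) ≤ (c (K ∩ Iic x)).toReal := ENNReal.toReal_nonneg
      have hrs : 0 < r ^ s := Real.rpow_pos_of_pos hr s
      have h3 : r ^ s ≤ (y - x) ^ s := Real.rpow_le_rpow hr.le h hs.le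
      calc (c (K ∩ Iic y)).toReal - (c (K ∩ Iic x)).toReal ≤ (c K).toReal := by linarith
        _ = (c K).toReal * (r ^ s)⁻¹ * r ^ s := by field_simp
        _ ≤ (c K).toReal * (r ^ s)⁻¹ * (y - x) ^ s := by gcongr
        _ ≤ _ := by gcongr; exact le_max_right _ _
  · intro x hx
    obtain ⟨ε, hε, hball⟩ := Metric.isOpen_iff.1 hCc.isOpen_compl x hx
    refine ⟨ε, hε, fun y hy => ?_⟩
    have hd : ∀ a b, |a - x| < ε → |b - x| < ε → K ∩ Icc a b = ∅ := by
      intro a b ha hb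
      refine eq_empty_of_forall_notMem fun z hz => hball ?_ hz.1.1
      rw [Metric.mem_ball, Real.dist_eq, abs_lt]
      rw [abs_lt] at ha hb
      have h1 := hz.2.1
      have h2 := hz.2.2
      constructor <;> linarith
    have h0 : |x - x| < ε := by simpa using hε
    rcases le_total x y with h | h
    · exact hconst x y h (hd x y h0 hy)
    · exact (hconst y x h (hd y x hy h0)).symm

/-! ### A distance to a closed subset of the line that is smooth on the gaps -/

/-- The last point of `Z` at or before `y`. -/
noncomputable def gapLeft (Z : Set ℝ) (y : ℝ) : ℝ := sSup (Z ∩ Iic y)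

/-- The first point of `Z` at or after `y`. -/
noncomputable def gapRight (Z : Set ℝ) (y : ℝ) : ℝ := sInf (Z ∩ Ici y)

/-- A substitute for the distance to `Z`: the harmonic combination `l r / (l + r)` of the distances
`l`, `r` from `y` to the two ends of the component of `Zᶜ` containing `y`. It is comparable to the
distance to `Z`, and it is a quadratic polynomial on each component of `Zᶜ`. On `Z` it is zero. -/
noncomputable def gapDist (Z : Set ℝ) (y : ℝ) : ℝ :=
  (y - gapLeft Z y) * (gapRight Z y - y) / (gapRight Z y - gapLeft Z y)

section Gap

variable {Z : Set ℝ} {y z a b : ℝ}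

theorem le_gapLeft (hz : z ∈ Z) (hzy : z ≤ y) : z ≤ gapLeft Z y :=
  le_csSup ⟨y, fun _ h => h.2⟩ ⟨hz, hzy⟩

theorem gapRight_le (hz : z ∈ Z) (hzy : y ≤ z) : gapRight Z y ≤ z :=
  csInf_le ⟨y, fun _ h => h.2⟩ ⟨hz, hzy⟩

theorem gapLeft_mem (hZ : IsClosed Z) (hl : (Z ∩ Iic y).Nonempty) : gapLeft Z y ∈ Z ∩ Iic y :=
  (hZ.inter isClosed_Iic).csSup_mem hl ⟨y, fun _ h => h.2⟩

theorem gapRight_mem (hZ : IsClosed Z) (hr : (Z ∩ Ici y).Nonempty) : gapRight Z y ∈ Z ∩ Ici y :=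
  (hZ.inter isClosed_Ici).csInf_mem hr ⟨y, fun _ h => h.2⟩

theorem gapLeft_lt (hZ : IsClosed Z) (hl : (Z ∩ Iic y).Nonempty) (hy : y ∉ Z) :
    gapLeft Z y < y :=
  lt_of_le_of_ne (gapLeft_mem hZ hl).2 fun h => hy (h ▸ (gapLeft_mem hZ hl).1)

theorem lt_gapRight (hZ : IsClosed Z) (hr : (Z ∩ Ici y).Nonempty) (hy : y ∉ Z) :
    y < gapRight Z y :=
  lt_of_le_of_ne (gapRight_mem hZ hr).2 fun h => hy (h ▸ (gapRight_mem hZ hr).1)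

theorem gapDist_eq_zero (hy : y ∈ Z) : gapDist Z y = 0 := by
  have h : gapLeft Z y = y :=
    le_antisymm (csSup_le ⟨y, hy, le_refl y⟩ fun _ h => h.2) (le_gapLeft hy le_rfl)
  simp [gapDist, h]

theorem gapDist_pos (hZ : IsClosed Z) (hl : (Z ∩ Iic y).Nonempty) (hr : (Z ∩ Ici y).Nonempty)
    (hy : y ∉ Z) : 0 < gapDist Z y := by
  have h1 := gapLeft_lt hZ hl hy
  have h2 := lt_gapRight hZ hr hy
  exact div_pos (mul_pos (by linarith) (by linarith)) (by linarith)

theorem gapDist_nonneg (hZ : IsClosed Z) (hl : (Z ∩ Iic y).Nonempty) (hr : (Z ∩ Ici y).Nonempty) :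
    0 ≤ gapDist Z y := by
  by_cases hy : y ∈ Z
  · exact (gapDist_eq_zero hy).ge
  · exact (gapDist_pos hZ hl hr hy).le

theorem gapDist_le_abs_sub (hZ : IsClosed Z) (hl : (Z ∩ Iic y).Nonempty)
    (hr : (Z ∩ Ici y).Nonempty) (hz : z ∈ Z) : gapDist Z y ≤ |y - z| := by
  by_cases hy : y ∈ Z
  · rw [gapDist_eq_zero hy]; exact abs_nonneg _
  have h1 := gapLeft_lt hZ hl hy
  have h2 := lt_gapRight hZ hr hy
  rw [gapDist, div_le_iff₀ (by linarith)]
  rcases le_total z y with h | h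
  · have h3 := le_gapLeft hz h
    rw [abs_of_nonneg (by linarith)]
    nlinarith
  · have h3 := gapRight_le hz h
    rw [abs_of_nonpos (by linarith)]
    nlinarith

theorem gapDist_eventuallyEq (hZ : IsClosed Z) (hy : y ∉ Z) :
    gapDist Z =ᶠ[nhds y]
      fun t => (t - gapLeft Z y) * (gapRight Z y - t) / (gapRight Z y - gapLeft Z y) := by
  obtain ⟨ε, hε, hball⟩ := Metric.isOpen_iff.1 hZ.isOpen_compl y hy
  filter_upwards [Metric.ball_mem_nhds y hε] with t ht
  have hmem : ∀ z ∈ Z, ε ≤ |z - y| := fun z hz => by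
    by_contra! h
    exact hball (by simpa [Real.dist_eq] using h) hz
  rw [Metric.mem_ball, Real.dist_eq, abs_lt] at ht
  have h1 : Z ∩ Iic t = Z ∩ Iic y := by
    ext z
    refine and_congr_right fun hz => ?_
    have := hmem z hz
    rw [mem_Iic, mem_Iic]
    rcases le_abs.1 this with h | h <;> constructor <;> intro _ <;> linarith
  have h2 : Z ∩ Ici t = Z ∩ Ici y := by
    ext z
    refine and_congr_right fun hz => ?_
    have := hmem z hz
    rw [mem_Ici, mem_Ici]
    rcases le_abs.1 this with h | h <;> constructor <;> intro _ <;> linarith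
  simp only [gapDist, gapLeft, gapRight, h1, h2]

theorem contDiffAt_gapDist (hZ : IsClosed Z) (hy : y ∉ Z) : ContDiffAt ℝ 1 (gapDist Z) y := by
  refine ContDiffAt.congr_of_eventuallyEq ?_ (gapDist_eventuallyEq hZ hy)
  fun_prop

theorem exists_hasDerivAt_gapDist (hZ : IsClosed Z) (hl : (Z ∩ Iic y).Nonempty)
    (hr : (Z ∩ Ici y).Nonempty) (hy : y ∉ Z) :
    ∃ d', |d'| ≤ 1 ∧ HasDerivAt (gapDist Z) d' y := by
  have h1 := gapLeft_lt hZ hl hy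
  have h2 := lt_gapRight hZ hr hy
  refine ⟨(1 * (gapRight Z y - y) + (y - gapLeft Z y) * (-1)) / (gapRight Z y - gapLeft Z y),
    ?_, HasDerivAt.congr_of_eventuallyEq ?_ (gapDist_eventuallyEq hZ hy)⟩
  · rw [abs_div, abs_of_pos (show 0 < gapRight Z y - gapLeft Z y by linarith),
      div_le_one (by linarith), abs_le]
    constructor <;> linarith
  · exact (((hasDerivAt_id y).sub_const _).mul ((hasDerivAt_id y).const_sub _)).div_const _

theorem measurable_gapDist (hZ : IsClosed Z) (hl : ∀ y, (Z ∩ Iic y).Nonempty)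
    (hr : ∀ y, (Z ∩ Ici y).Nonempty) : Measurable (gapDist Z) := by
  have h1 : Measurable (gapLeft Z) := Monotone.measurable fun x y hxy =>
    le_gapLeft (gapLeft_mem hZ (hl x)).1 ((gapLeft_mem hZ (hl x)).2.trans hxy)
  have h2 : Measurable (gapRight Z) := Monotone.measurable fun x y hxy =>
    gapRight_le (gapRight_mem hZ (hr y)).1 (hxy.trans (gapRight_mem hZ (hr y)).2)
  unfold gapDist
  fun_prop

theorem gapDist_rpow_le (hZ : IsClosed Z) (hl : (Z ∩ Iic y).Nonempty)
    (hr : (Z ∩ Ici y).Nonempty) (hab : Disjoint (Ioo a b) Z) (hy : y ∈ Ioo a b) {α : ℝ}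
    (hα : 0 ≤ α) (hα1 : α ≤ 1) :
    gapDist Z y ^ (α - 1) ≤ (y - a) ^ (α - 1) + (b - y) ^ (α - 1) := by
  have hyZ : y ∉ Z := disjoint_left.1 hab hy
  have h1 := gapLeft_lt hZ hl hyZ
  have h2 := lt_gapRight hZ hr hyZ
  have hla : gapLeft Z y ≤ a := by
    by_contra! h
    exact disjoint_left.1 hab ⟨h, h1.trans hy.2⟩ (gapLeft_mem hZ hl).1
  have hrb : b ≤ gapRight Z y := by
    by_contra! h
    exact disjoint_left.1 hab ⟨hy.1.trans h2, h⟩ (gapRight_mem hZ hr).1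
  have ha : 0 < y - a := by linarith [hy.1]
  have hb : 0 < b - y := by linarith [hy.2]
  have hinv : (gapDist Z y)⁻¹ ≤ (y - a)⁻¹ + (b - y)⁻¹ := by
    have : (gapDist Z y)⁻¹ = (y - gapLeft Z y)⁻¹ + (gapRight Z y - y)⁻¹ := by
      have h3 : y - gapLeft Z y ≠ 0 := by linarith
      have h4 : gapRight Z y - y ≠ 0 := by linarith
      rw [gapDist]
      field_simp
      ring
    rw [this]
    gcongr
  have hneg : ∀ x : ℝ, 0 ≤ x → x ^ (α - 1) = (x⁻¹) ^ (1 - α) := fun x hx => by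
    rw [Real.inv_rpow hx, ← Real.rpow_neg hx, neg_sub]
  rw [hneg _ (gapDist_nonneg hZ hl hr), hneg _ ha.le, hneg _ hb.le]
  exact (Real.rpow_le_rpow (inv_nonneg.2 (gapDist_nonneg hZ hl hr)) hinv (by linarith)).trans
    (Real.rpow_add_le_add_rpow (by positivity) (by positivity) (by linarith) (by linarith))

theorem lintegral_gapDist_rpow_le (hZ : IsClosed Z) (hl : ∀ y, (Z ∩ Iic y).Nonempty)
    (hr : ∀ y, (Z ∩ Ici y).Nonempty) (hab : Disjoint (Ioo a b) Z) {α ℓ : ℝ}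
    (hα : 0 < α) (hα1 : α ≤ 1) (hℓ : b - a ≤ ℓ) :
    ∫⁻ y in Ioo a b, ENNReal.ofReal (gapDist Z y ^ (α - 1)) ≤ ENNReal.ofReal (2 / α * ℓ ^ α) := by
  rcases le_or_gt b a with hba | hba
  · simp [Ioo_eq_empty_of_le hba]
  have hi : IntervalIntegrable (fun x : ℝ => x ^ (α - 1)) volume 0 (b - a) :=
    intervalIntegral.intervalIntegrable_rpow' (by linarith)
  have hi1 : IntervalIntegrable (fun y : ℝ => (y - a) ^ (α - 1)) volume a b := by
    simpa using hi.comp_sub_right a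
  have hi2 : IntervalIntegrable (fun y : ℝ => (b - y) ^ (α - 1)) volume a b := by
    simpa using (hi.comp_sub_left b).symm
  have hint : ∫ x in (0 : ℝ)..(b - a), x ^ (α - 1) = (b - a) ^ α / α := by
    rw [integral_rpow (Or.inl (by linarith))]
    simp [Real.zero_rpow hα.ne']
  have hsum : ∫ y in a..b, ((y - a) ^ (α - 1) + (b - y) ^ (α - 1)) = 2 / α * (b - a) ^ α := by
    rw [intervalIntegral.integral_add hi1 hi2,
      intervalIntegral.integral_comp_sub_right (fun x => x ^ (α - 1)),
      intervalIntegral.integral_comp_sub_left (fun x => x ^ (α - 1)), sub_self, sub_self, hint]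
    ring
  calc ∫⁻ y in Ioo a b, ENNReal.ofReal (gapDist Z y ^ (α - 1))
      ≤ ∫⁻ y in Ioo a b, ENNReal.ofReal ((y - a) ^ (α - 1) + (b - y) ^ (α - 1)) :=
        setLIntegral_mono' measurableSet_Ioo fun y hy => ENNReal.ofReal_le_ofReal
          (gapDist_rpow_le hZ (hl y) (hr y) hab hy hα.le hα1)
    _ = ENNReal.ofReal (2 / α * (b - a) ^ α) := by
        rw [← hsum, intervalIntegral.integral_of_le hba.le, integral_Ioc_eq_integral_Ioo,
          ofReal_integral_eq_lintegral_ofReal]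
        · exact ((intervalIntegrable_iff_integrableOn_Ioo_of_le hba.le).1 (hi1.add hi2))
        · refine (ae_restrict_iff' measurableSet_Ioo).2 (ae_of_all _ fun y hy => ?_)
          exact add_nonneg (Real.rpow_nonneg (by linarith [hy.1]) _)
            (Real.rpow_nonneg (by linarith [hy.2]) _)
    _ ≤ ENNReal.ofReal (2 / α * ℓ ^ α) := by
        refine ENNReal.ofReal_le_ofReal ?_
        gcongr

end Gap

/-! ### Sliding means of a monotone function -/

/-- The mean of `f` over `[x, x + δ]`, with the limit value `f x` at `δ = 0`. -/
noncomputable def slidingMean (f : ℝ → ℝ) (x δ : ℝ) : ℝ :=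
  if δ = 0 then f x else (∫ t in x..(x + δ), f t) / δ

/-- The mean slope of `f` over `[x, x + δ]`; it is `0` at `δ = 0`. -/
noncomputable def meanSlope (f : ℝ → ℝ) (x δ : ℝ) : ℝ := (f (x + δ) - f x) / δ

section SlidingMean

variable {f : ℝ → ℝ} {x y δ : ℝ}

theorem slidingMean_zero : slidingMean f x 0 = f x := if_pos rfl

theorem meanSlope_nonneg (hf : Monotone f) (hδ : 0 ≤ δ) : 0 ≤ meanSlope f x δ :=
  div_nonneg (sub_nonneg.2 (hf (by linarith))) hδ

theorem mul_le_integral_of_monotone (hf : Monotone f) (hδ : 0 ≤ δ) :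
    f x * δ ≤ ∫ t in x..(x + δ), f t := by
  have := intervalIntegral.integral_mono_on (a := x) (b := x + δ) (by linarith)
    (intervalIntegrable_const (c := f x) (μ := volume)) hf.intervalIntegrable fun t ht => hf ht.1
  simpa [mul_comm] using this

theorem integral_le_mul_of_monotone (hf : Monotone f) (hδ : 0 ≤ δ) :
    ∫ t in x..(x + δ), f t ≤ f (x + δ) * δ := by
  have := intervalIntegral.integral_mono_on (a := x) (b := x + δ) (by linarith)
    hf.intervalIntegrable (intervalIntegrable_const (c := f (x + δ)) (μ := volume))
    fun t ht => hf ht.2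
  simpa [mul_comm] using this

theorem slidingMean_mem_Icc (hf : Monotone f) (hδ : 0 ≤ δ) :
    slidingMean f x δ ∈ Icc (f x) (f (x + δ)) := by
  rcases hδ.eq_or_lt with rfl | h
  · simp [slidingMean_zero]
  · rw [slidingMean, if_neg h.ne']
    exact ⟨(le_div_iff₀ h).2 (mul_le_integral_of_monotone hf hδ),
      (div_le_iff₀ h).2 (integral_le_mul_of_monotone hf hδ)⟩

theorem slidingMean_eq_primitive (hf : Continuous f) (hδ : δ ≠ 0) :
    slidingMean f x δ = ((∫ t in (0 : ℝ)..(x + δ), f t) - ∫ t in (0 : ℝ)..x, f t) / δ := by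
  rw [slidingMean, if_neg hδ, intervalIntegral.integral_interval_sub_left
    (hf.intervalIntegrable _ _) (hf.intervalIntegrable _ _)]

theorem hasDerivAt_primitive (hf : Continuous f) (x : ℝ) :
    HasDerivAt (fun x => ∫ t in (0 : ℝ)..x, f t) (f x) x :=
  (hf.integral_hasStrictDerivAt 0 x).hasDerivAt

theorem contDiff_primitive (hf : Continuous f) :
    ContDiff ℝ 1 fun x => ∫ t in (0 : ℝ)..x, f t := by
  have h := hasDerivAt_primitive hf
  rw [contDiff_one_iff_deriv]
  refine ⟨fun x => (h x).differentiableAt, ?_⟩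
  rwa [show deriv (fun x => ∫ t in (0 : ℝ)..x, f t) = f from funext fun x => (h x).deriv]

theorem hasDerivAt_slidingMean_left (hf : Continuous f) (hδ : δ ≠ 0) :
    HasDerivAt (fun t => slidingMean f t δ) (meanSlope f x δ) x := by
  have h := hasDerivAt_primitive hf
  simp only [slidingMean_eq_primitive hf hδ]
  exact (((h (x + δ)).comp_add_const x δ).sub (h x)).div_const δ

/-- Since `f` is monotone, the derivative of the sliding mean in the length of the window is also
bounded by the mean slope. -/
theorem exists_hasDerivAt_slidingMean_right (hf : Continuous f) (hm : Monotone f) (hδ : 0 < δ) :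
    ∃ D, |D| ≤ meanSlope f x δ ∧ HasDerivAt (fun t => slidingMean f x t) D δ := by
  have h := hasDerivAt_primitive hf
  refine ⟨(f (x + δ) * δ - ((∫ t in (0 : ℝ)..(x + δ), f t) - ∫ t in (0 : ℝ)..x, f t) * 1) / δ ^ 2,
    ?_, HasDerivAt.congr_of_eventuallyEq ?_
      ((eventually_ne_nhds hδ.ne').mono fun t ht => slidingMean_eq_primitive hf ht)⟩
  · rw [intervalIntegral.integral_interval_sub_left
      (hf.intervalIntegrable _ _) (hf.intervalIntegrable _ _), meanSlope, mul_one]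
    have h1 := mul_le_integral_of_monotone (x := x) hm hδ.le
    have h2 := integral_le_mul_of_monotone (x := x) hm hδ.le
    rw [abs_of_nonneg (div_nonneg (by linarith) (by positivity)),
      div_le_div_iff₀ (by positivity) hδ]
    nlinarith
  · exact (((h (x + δ)).comp_const_add x δ).sub_const _).div (hasDerivAt_id δ) hδ.ne'

/-- The mean slopes of a bounded monotone `s`-Hölder function over windows of length `δ` have
`p`-th powers with integral at most a constant times `δ ^ ((s - 1) (p - 1))`: one factor has
bounded total integral, and each of the other `p - 1` factors is at most `A δ ^ (s - 1)`. -/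
theorem lintegral_meanSlope_rpow_le (hf : Continuous f) (hm : Monotone f) {M A s p L : ℝ}
    (hf0 : ∀ x, 0 ≤ f x) (hfM : ∀ x, f x ≤ M)
    (hA : 0 ≤ A) (hH : ∀ x y, x ≤ y → f y - f x ≤ A * (y - x) ^ s) (hp : 1 ≤ p) (hL : 0 ≤ L)
    (hδ : 0 < δ) :
    ∫⁻ x in Icc (-L) L, ENNReal.ofReal (meanSlope f x δ ^ p)
      ≤ ENNReal.ofReal (A ^ (p - 1) * M * δ ^ ((s - 1) * (p - 1))) := by
  have hpt : ∀ x, meanSlope f x δ ^ p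
      ≤ A ^ (p - 1) * δ ^ ((s - 1) * (p - 1)) * δ⁻¹ * (f (x + δ) - f x) := fun x => by
    have h0 : 0 ≤ meanSlope f x δ := meanSlope_nonneg hm hδ.le
    have h1 : meanSlope f x δ ≤ A * δ ^ (s - 1) := by
      rw [meanSlope, div_le_iff₀ hδ, mul_assoc, ← Real.rpow_add_one hδ.ne', sub_add_cancel]
      simpa using hH x (x + δ) (by linarith)
    calc meanSlope f x δ ^ p = meanSlope f x δ ^ (p - 1) * meanSlope f x δ := by
          rw [← Real.rpow_add_one' h0 (by linarith), sub_add_cancel]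
      _ ≤ (A * δ ^ (s - 1)) ^ (p - 1) * meanSlope f x δ := by
          gcongr
      _ = _ := by
          rw [Real.mul_rpow hA (by positivity), ← Real.rpow_mul hδ.le, meanSlope]
          ring
  have hfi : ∀ a b, IntervalIntegrable f volume a b := fun a b => hf.intervalIntegrable a b
  have hc : Continuous fun x => f (x + δ) := by fun_prop
  have hint : ∫ x in (-L)..L, (f (x + δ) - f x) ≤ M * δ := by
    rw [intervalIntegral.integral_sub (hc.intervalIntegrable _ _) (hfi _ _),
      intervalIntegral.integral_comp_add_right,
      intervalIntegral.integral_interval_sub_interval_comm' (hfi _ _) (hfi _ _) (hfi _ _)]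
    have h1 := integral_le_mul_of_monotone (x := L) hm hδ.le
    have h2 : 0 ≤ ∫ t in (-L)..(-L + δ), f t :=
      intervalIntegral.integral_nonneg (by linarith) fun t _ => hf0 t
    have h3 := mul_le_mul_of_nonneg_right (hfM (L + δ)) hδ.le
    linarith
  set B := A ^ (p - 1) * δ ^ ((s - 1) * (p - 1)) * δ⁻¹ with hB
  have hB0 : 0 ≤ B := by positivity
  calc ∫⁻ x in Icc (-L) L, ENNReal.ofReal (meanSlope f x δ ^ p)
      ≤ ∫⁻ x in Icc (-L) L, ENNReal.ofReal (B * (f (x + δ) - f x)) :=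
        lintegral_mono fun x => ENNReal.ofReal_le_ofReal (hpt x)
    _ = ENNReal.ofReal (∫ x in (-L)..L, B * (f (x + δ) - f x)) := by
        rw [intervalIntegral.integral_of_le (by linarith), ← integral_Icc_eq_integral_Ioc,
          ofReal_integral_eq_lintegral_ofReal]
        · exact (Continuous.continuousOn (by fun_prop)).integrableOn_Icc
        · exact ae_of_all _ fun x => mul_nonneg hB0 (sub_nonneg.2 (hm (by linarith)))
    _ ≤ _ := by
        refine ENNReal.ofReal_le_ofReal ?_
        rw [intervalIntegral.integral_const_mul]
        calc B * ∫ x in (-L)..L, (f (x + δ) - f x) ≤ B * (M * δ) := by gcongr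
          _ = _ := by rw [hB]; field_simp

end SlidingMean

/-! ### The sliding mean over windows of length `gapDist` -/

/-- The function on the plane that is `f` on the horizontal lines at heights in `Z`, and that on
the line at height `y` is the mean of `f` over windows of length comparable to the distance from
`y` to `Z`. -/
noncomputable def gapMean (f : ℝ → ℝ) (Z : Set ℝ) (z : ℝ × ℝ) : ℝ :=
  slidingMean f z.1 (gapDist Z z.2)

section GapMean

variable {f : ℝ → ℝ} {Z : Set ℝ}

theorem gapMean_of_mem {z : ℝ × ℝ} (hz : z.2 ∈ Z) : gapMean f Z z = f z.1 := by
  rw [gapMean, gapDist_eq_zero hz, slidingMean_zero]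

theorem contDiffAt_gapMean (hf : Continuous f) (hZ : IsClosed Z)
    (hl : ∀ y, (Z ∩ Iic y).Nonempty) (hr : ∀ y, (Z ∩ Ici y).Nonempty) {z : ℝ × ℝ} (hz : z.2 ∉ Z) :
    ContDiffAt ℝ 1 (gapMean f Z) z := by
  have hd : ContDiffAt ℝ 1 (fun z : ℝ × ℝ => gapDist Z z.2) z :=
    (contDiffAt_gapDist hZ hz).comp z contDiffAt_snd
  have hd0 : gapDist Z z.2 ≠ 0 := (gapDist_pos hZ (hl _) (hr _) hz).ne'
  have heq : gapMean f Z =ᶠ[nhds z] fun z => ((∫ t in (0 : ℝ)..(z.1 + gapDist Z z.2), f t)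
      - ∫ t in (0 : ℝ)..z.1, f t) / gapDist Z z.2 := by
    filter_upwards [hd.continuousAt.eventually_ne hd0] with t ht
      using slidingMean_eq_primitive hf ht
  refine ContDiffAt.congr_of_eventuallyEq ?_ heq
  refine ContDiffAt.div (ContDiffAt.sub ?_ ?_) hd hd0
  · exact (contDiff_primitive hf).contDiffAt.comp z (contDiffAt_fst.add hd)
  · exact (contDiff_primitive hf).contDiffAt.comp z contDiffAt_fst

/-- At a height in `Z`, the windows are short, so that `gapMean` is constant near every point
around which `f` is constant. -/
theorem gapMean_eventuallyEq_const (hm : Monotone f) (hZ : IsClosed Z)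
    (hl : ∀ y, (Z ∩ Iic y).Nonempty) (hr : ∀ y, (Z ∩ Ici y).Nonempty) {z : ℝ × ℝ} (hz : z.2 ∈ Z)
    (hf : ∃ ε > 0, ∀ x, |x - z.1| < ε → f x = f z.1) :
    gapMean f Z =ᶠ[nhds z] fun _ => f z.1 := by
  obtain ⟨ε, hε, hconst⟩ := hf
  filter_upwards [Metric.ball_mem_nhds z (half_pos hε)] with t ht
  rw [Metric.mem_ball, Prod.dist_eq, max_lt_iff, Real.dist_eq, Real.dist_eq] at ht
  have h0 := gapDist_nonneg hZ (hl t.2) (hr t.2)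
  have h1 := (gapDist_le_abs_sub hZ (hl t.2) (hr t.2) hz).trans_lt ht.2
  have h2 := slidingMean_mem_Icc (x := t.1) hm h0
  have h3 := abs_lt.1 ht.1
  rw [hconst t.1 (by linarith [ht.1]),
    hconst (t.1 + gapDist Z t.2) (abs_lt.2 ⟨by linarith, by linarith⟩), Icc_self] at h2
  exact h2

theorem norm_fderiv_gapMean_apply_le (hf : Continuous f) (hm : Monotone f) (hZ : IsClosed Z)
    (hl : ∀ y, (Z ∩ Iic y).Nonempty) (hr : ∀ y, (Z ∩ Ici y).Nonempty) {z : ℝ × ℝ} (hz : z.2 ∉ Z) :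
    |fderiv ℝ (gapMean f Z) z (1, 0)| ≤ meanSlope f z.1 (gapDist Z z.2) ∧
      |fderiv ℝ (gapMean f Z) z (0, 1)| ≤ meanSlope f z.1 (gapDist Z z.2) := by
  obtain ⟨x, y⟩ := z
  have hd := gapDist_pos hZ (hl _) (hr _) hz
  have hF := ((contDiffAt_gapMean hf hZ hl hr hz).differentiableAt one_ne_zero).hasFDerivAt
  have h1 : HasDerivAt (fun t => gapMean f Z (t, y)) (fderiv ℝ (gapMean f Z) (x, y) (1, 0)) x :=
    hF.comp_hasDerivAt (f := fun t => (t, y)) x ((hasDerivAt_id x).prodMk (hasDerivAt_const x y))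
  have h2 : HasDerivAt (fun t => gapMean f Z (x, t)) (fderiv ℝ (gapMean f Z) (x, y) (0, 1)) y :=
    hF.comp_hasDerivAt (f := fun t => (x, t)) y ((hasDerivAt_const y x).prodMk (hasDerivAt_id y))
  constructor
  · rw [h1.unique (hasDerivAt_slidingMean_left hf hd.ne'),
      abs_of_nonneg (meanSlope_nonneg hm hd.le)]
  · obtain ⟨D, hD, hD'⟩ := exists_hasDerivAt_slidingMean_right (x := x) hf hm hd
    obtain ⟨d', hd', hdd⟩ := exists_hasDerivAt_gapDist hZ (hl y) (hr y) hz
    rw [h2.unique (hD'.comp y hdd), abs_mul]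
    exact (mul_le_of_le_one_right (abs_nonneg _) hd').trans hD

/-- The mean slope that bounds the gradient of `gapMean` is in `L^p` of a rectangle. Integrating in
the horizontal variable first leaves `∫ gapDist ^ (α - 1)` over the gaps, where
`α - 1 = (s - 1) (p - 1)`, and each gap contributes a multiple of its length to the power `α`. -/
theorem lintegral_meanSlope_gapDist_lt_top (hf : Continuous f) (hm : Monotone f)
    (hZ : IsClosed Z) (hl : ∀ y, (Z ∩ Iic y).Nonempty) (hr : ∀ y, (Z ∩ Ici y).Nonempty)
    {M A s p L : ℝ} (hf0 : ∀ x, 0 ≤ f x) (hfM : ∀ x, f x ≤ M) (hA : 0 ≤ A)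
    (hH : ∀ x y, x ≤ y → f y - f x ≤ A * (y - x) ^ s) (hp : 1 ≤ p) (hL : 0 ≤ L) (hs1 : s ≤ 1)
    (hα : 0 < (s - 1) * (p - 1) + 1) {S : Set ℝ} {a b ℓ : ℕ → ℝ}
    (hcov : S \ Z ⊆ ⋃ j, Ioo (a j) (b j)) (hdisj : ∀ j, Disjoint (Ioo (a j) (b j)) Z)
    (hℓ : ∀ j, b j - a j ≤ ℓ j)
    (hsum : Summable fun j => ℓ j ^ ((s - 1) * (p - 1) + 1)) :
    ∫⁻ z in Icc (-L) L ×ˢ S, ENNReal.ofReal (meanSlope f z.1 (gapDist Z z.2) ^ p) < ⊤ := by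
  set α := (s - 1) * (p - 1) + 1 with hαdef
  have hα1 : α ≤ 1 := by nlinarith
  have hd := measurable_gapDist hZ hl hr
  have hmeas : Measurable fun z : ℝ × ℝ =>
      ENNReal.ofReal (meanSlope f z.1 (gapDist Z z.2) ^ p) := by
    unfold meanSlope
    have := hf.measurable
    fun_prop
  have hM : 0 ≤ M := (hf0 0).trans (hfM 0)
  set B := A ^ (p - 1) * M with hB
  have hB0 : 0 ≤ B := by positivity
  have hrow : ∀ y, ∫⁻ x in Icc (-L) L, ENNReal.ofReal (meanSlope f x (gapDist Z y) ^ p)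
      ≤ Zᶜ.indicator (fun y => ENNReal.ofReal B * ENNReal.ofReal (gapDist Z y ^ (α - 1))) y := by
    intro y
    by_cases hy : y ∈ Z
    · rw [gapDist_eq_zero hy]
      simp [meanSlope, Real.zero_rpow (show p ≠ 0 by linarith)]
    · rw [indicator_of_mem (show y ∈ Zᶜ from hy), ← ENNReal.ofReal_mul hB0]
      have := lintegral_meanSlope_rpow_le hf hm hf0 hfM hA hH hp hL
        (gapDist_pos hZ (hl y) (hr y) hy)
      rwa [show (s - 1) * (p - 1) = α - 1 by rw [hαdef]; ring] at this
  have htsum : ∑' j, ENNReal.ofReal (2 / α * ℓ j ^ α) < ⊤ :=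
    (hsum.mul_left (2 / α)).tsum_ofReal_lt_top
  calc ∫⁻ z in Icc (-L) L ×ˢ S, ENNReal.ofReal (meanSlope f z.1 (gapDist Z z.2) ^ p)
      = ∫⁻ y in S, ∫⁻ x in Icc (-L) L, ENNReal.ofReal (meanSlope f x (gapDist Z y) ^ p) := by
        rw [Measure.volume_eq_prod, ← Measure.prod_restrict, lintegral_prod_symm' _ hmeas]
    _ ≤ ∫⁻ y in S,
          Zᶜ.indicator (fun y => ENNReal.ofReal B * ENNReal.ofReal (gapDist Z y ^ (α - 1))) y :=
        lintegral_mono fun y => hrow y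
    _ = ENNReal.ofReal B * ∫⁻ y in Zᶜ ∩ S, ENNReal.ofReal (gapDist Z y ^ (α - 1)) := by
        rw [lintegral_indicator hZ.isOpen_compl.measurableSet,
          Measure.restrict_restrict hZ.isOpen_compl.measurableSet,
          lintegral_const_mul _ (by fun_prop)]
    _ ≤ ENNReal.ofReal B * ∑' j, ENNReal.ofReal (2 / α * ℓ j ^ α) := by
        gcongr
        refine (lintegral_mono_set (t := ⋃ j, Ioo (a j) (b j)) fun y hy => hcov ⟨hy.2, hy.1⟩).trans
          ((lintegral_iUnion_le _ _).trans (ENNReal.tsum_le_tsum fun j => ?_))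
        exact lintegral_gapDist_rpow_le hZ hl hr (hdisj j) hα hα1 (hℓ j)
    _ < ⊤ := ENNReal.mul_lt_top ENNReal.ofReal_lt_top htsum

end GapMean

/-! ### Classical and weak derivatives -/

section Weak

variable {Ω : Set (ℝ × ℝ)} {w : ℝ × ℝ → ℝ}

theorem integrable_mul_of_continuousOn {h φ : ℝ × ℝ → ℝ} (hh : ContinuousOn h Ω)
    (hφ : Continuous φ) (hφc : HasCompactSupport φ) (hφΩ : tsupport φ ⊆ Ω) :
    Integrable fun z => h z * φ z := by
  rw [← integrableOn_iff_integrable_of_support_subset (s := tsupport φ)]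
  · exact ((hh.mono hφΩ).mul hφ.continuousOn).integrableOn_compact hφc
  · exact (Function.support_mul_subset_right h φ).trans (subset_tsupport φ)

theorem hasWeakPartialDeriv_fderiv (hΩ : IsOpen Ω) (hw : ContDiffOn ℝ 1 w Ω) (e : ℝ × ℝ) :
    HasWeakPartialDeriv Ω e w fun z => fderiv ℝ w z e := by
  have hw' : ContinuousOn (fun z => fderiv ℝ w z e) Ω :=
    (hw.continuousOn_fderiv_of_isOpen hΩ le_rfl).clm_apply continuousOn_const
  refine ⟨hw.continuousOn.locallyIntegrableOn hΩ.measurableSet,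
    hw'.locallyIntegrableOn hΩ.measurableSet, fun φ hφ hφc hφΩ => ?_⟩
  have hφ' : Continuous fun z => fderiv ℝ φ z e :=
    (hφ.continuous_fderiv (by simp)).clm_apply continuous_const
  have hφ's : tsupport (fun z => fderiv ℝ φ z e) ⊆ tsupport φ := tsupport_fderiv_apply_subset ℝ e
  have hout : ∀ z ∉ Ω, z ∉ tsupport φ := fun z hz h => hz (hφΩ h)
  rw [setIntegral_eq_integral_of_forall_compl_eq_zero,
    setIntegral_eq_integral_of_forall_compl_eq_zero]
  · refine integral_mul_fderiv_eq_neg_fderiv_mul_of_integrable ?_ ?_ ?_ ?_ ?_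
    · exact integrable_mul_of_continuousOn hw' hφ.continuous hφc hφΩ
    · exact integrable_mul_of_continuousOn hw.continuousOn hφ' (hφc.fderiv_apply (𝕜 := ℝ) e)
        (hφ's.trans hφΩ)
    · exact integrable_mul_of_continuousOn hw.continuousOn hφ.continuous hφc hφΩ
    · exact fun z hz => (hw.differentiableOn one_ne_zero).differentiableAt (hΩ.mem_nhds (hφΩ hz))
    · exact fun z _ => hφ.differentiable (by simp) z
  · intro z hz
    rw [image_eq_zero_of_notMem_tsupport (hout z hz), mul_zero]
  · intro z hz
    rw [image_eq_zero_of_notMem_tsupport fun h => hout z hz (hφ's h), mul_zero]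

theorem mem_sobolevW1_of_contDiffOn (hΩ : IsOpen Ω) (hw : ContDiffOn ℝ 1 w Ω) {p : ENNReal}
    (h0 : MemLp w p (volume.restrict Ω))
    (h1 : MemLp (fun z => fderiv ℝ w z (1, 0)) p (volume.restrict Ω))
    (h2 : MemLp (fun z => fderiv ℝ w z (0, 1)) p (volume.restrict Ω)) : w ∈ sobolevW1 Ω p :=
  ⟨h0, ⟨_, h1, hasWeakPartialDeriv_fderiv hΩ hw _⟩, ⟨_, h2, hasWeakPartialDeriv_fderiv hΩ hw _⟩⟩

/-- A weak derivative on the plane agrees with the classical one where that exists. -/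
theorem HasWeakPartialDeriv.ae_eq_fderiv (hΩ : IsOpen Ω) (hw : ContDiffOn ℝ 1 w Ω) {e : ℝ × ℝ}
    {g : ℝ × ℝ → ℝ} (hg : HasWeakPartialDeriv univ e w g) :
    ∀ᵐ z, z ∈ Ω → g z = fderiv ℝ w z e := by
  have hw' : ContinuousOn (fun z => fderiv ℝ w z e) Ω :=
    (hw.continuousOn_fderiv_of_isOpen hΩ le_rfl).clm_apply continuousOn_const
  have hgl : LocallyIntegrable g := locallyIntegrableOn_univ.1 hg.2.1
  have := hΩ.ae_eq_zero_of_integral_contDiff_smul_eq_zero (μ := volume)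
    (f := fun z => g z - fderiv ℝ w z e)
    ((hgl.locallyIntegrableOn Ω).sub (hw'.locallyIntegrableOn hΩ.measurableSet))
    fun φ hφ hφc hφΩ => ?_
  · filter_upwards [this] with z hz hzΩ using sub_eq_zero.1 (hz hzΩ)
  have hφ' : ContDiff ℝ (⊤ : ℕ∞) φ := hφ
  have hφ's : tsupport (fun z => fderiv ℝ φ z e) ⊆ tsupport φ := tsupport_fderiv_apply_subset ℝ e
  have e1 := hg.2.2 φ hφ' hφc (subset_univ _)
  have e2 := (hasWeakPartialDeriv_fderiv hΩ hw e).2.2 φ hφ' hφc hφΩ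
  rw [setIntegral_univ, setIntegral_univ] at e1
  rw [setIntegral_eq_integral_of_forall_compl_eq_zero fun z hz => by
      rw [image_eq_zero_of_notMem_tsupport fun h => hz (hφΩ (hφ's h)), mul_zero],
    setIntegral_eq_integral_of_forall_compl_eq_zero fun z hz => by
      rw [image_eq_zero_of_notMem_tsupport fun h => hz (hφΩ h), mul_zero], e1] at e2
  have i1 : Integrable fun z => g z * φ z := by
    simpa [mul_comm] using
      hgl.integrable_smul_left_of_hasCompactSupport hφ.continuous hφc
  have i2 := integrable_mul_of_continuousOn hw' hφ.continuous hφc hφΩ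
  calc ∫ z, φ z • (g z - fderiv ℝ w z e) = ∫ z, (g z * φ z - fderiv ℝ w z e * φ z) := by
        congr 1; ext z; rw [smul_eq_mul]; ring
    _ = 0 := by rw [integral_sub i1 i2]; linarith

end Weak

/-! ### The cut-off sliding mean is a Sobolev function off `C × F` -/

section CutOff

variable {f : ℝ → ℝ} {Z S : Set ℝ} {Ω : Set (ℝ × ℝ)} {η : ℝ × ℝ → ℝ} {M L : ℝ}

theorem gapMean_mem_Icc (hm : Monotone f) (hf0 : ∀ x, 0 ≤ f x) (hfM : ∀ x, f x ≤ M)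
    (hZ : IsClosed Z) (hl : ∀ y, (Z ∩ Iic y).Nonempty) (hr : ∀ y, (Z ∩ Ici y).Nonempty)
    (z : ℝ × ℝ) : gapMean f Z z ∈ Icc 0 M :=
  have h := slidingMean_mem_Icc (x := z.1) hm (gapDist_nonneg hZ (hl z.2) (hr z.2))
  ⟨(hf0 _).trans h.1, h.2.trans (hfM _)⟩

theorem contDiffAt_gapMean_and_norm_fderiv_le (hf : Continuous f) (hm : Monotone f)
    (hZ : IsClosed Z) (hl : ∀ y, (Z ∩ Iic y).Nonempty) (hr : ∀ y, (Z ∩ Ici y).Nonempty)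
    {z : ℝ × ℝ} (hz : z.2 ∈ Z → ∃ ε > 0, ∀ x, |x - z.1| < ε → f x = f z.1) :
    ContDiffAt ℝ 1 (gapMean f Z) z ∧
      |fderiv ℝ (gapMean f Z) z (1, 0)| ≤ meanSlope f z.1 (gapDist Z z.2) ∧
      |fderiv ℝ (gapMean f Z) z (0, 1)| ≤ meanSlope f z.1 (gapDist Z z.2) := by
  by_cases hzZ : z.2 ∈ Z
  · have h := gapMean_eventuallyEq_const hm hZ hl hr hzZ (hz hzZ)
    refine ⟨contDiffAt_const.congr_of_eventuallyEq h, ?_⟩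
    rw [h.fderiv_eq]
    simp [meanSlope, gapDist_eq_zero hzZ]
  · exact ⟨contDiffAt_gapMean hf hZ hl hr hzZ, norm_fderiv_gapMean_apply_le hf hm hZ hl hr hzZ⟩

theorem contDiffOn_mul_gapMean (hf : Continuous f) (hm : Monotone f) (hZ : IsClosed Z)
    (hl : ∀ y, (Z ∩ Iic y).Nonempty) (hr : ∀ y, (Z ∩ Ici y).Nonempty)
    (hconst : ∀ z ∈ Ω, z.2 ∈ S → z.2 ∈ Z → ∃ ε > 0, ∀ x, |x - z.1| < ε → f x = f z.1)
    (hη : ContDiff ℝ 1 η) (hηS : tsupport η ⊆ Icc (-L) L ×ˢ S) :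
    ContDiffOn ℝ 1 (fun z => η z * gapMean f Z z) Ω := by
  intro z hz
  refine ContDiffAt.contDiffWithinAt ?_
  by_cases hzη : z ∈ tsupport η
  · exact hη.contDiffAt.mul (contDiffAt_gapMean_and_norm_fderiv_le hf hm hZ hl hr
      (hconst z hz (hηS hzη).2)).1
  · refine contDiffAt_const (c := (0 : ℝ)).congr_of_eventuallyEq ?_
    filter_upwards [notMem_tsupport_iff_eventuallyEq.1 hzη] with t ht
    simp [ht]

theorem mul_gapMean_mem_sobolevW1 (hf : Continuous f) (hm : Monotone f) (hf0 : ∀ x, 0 ≤ f x)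
    (hfM : ∀ x, f x ≤ M) (hZ : IsClosed Z)
    (hl : ∀ y, (Z ∩ Iic y).Nonempty) (hr : ∀ y, (Z ∩ Ici y).Nonempty) (hΩ : IsOpen Ω)
    (hconst : ∀ z ∈ Ω, z.2 ∈ S → z.2 ∈ Z → ∃ ε > 0, ∀ x, |x - z.1| < ε → f x = f z.1)
    (hη : ContDiff ℝ 1 η) (hηc : HasCompactSupport η) (hη1 : ∀ z, |η z| ≤ 1)
    (hS : MeasurableSet S) (hSb : volume S ≠ ⊤) (hηS : tsupport η ⊆ Icc (-L) L ×ˢ S)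
    {p : ℝ} (hp : 0 < p)
    (hint : ∫⁻ z in Icc (-L) L ×ˢ S, ENNReal.ofReal (meanSlope f z.1 (gapDist Z z.2) ^ p) < ⊤) :
    (fun z => η z * gapMean f Z z) ∈ sobolevW1 Ω (ENNReal.ofReal p) := by
  set B : Set (ℝ × ℝ) := Icc (-L) L ×ˢ S with hB
  have hBm : MeasurableSet B := measurableSet_Icc.prod hS
  have hBv : volume B ≠ ⊤ := by
    rw [hB, Measure.volume_eq_prod, Measure.prod_prod, Real.volume_Icc]
    exact ENNReal.mul_ne_top ENNReal.ofReal_ne_top hSb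
  have hM : 0 ≤ M := (hf0 0).trans (hfM 0)
  have hp0 : ENNReal.ofReal p ≠ 0 := by simpa using hp
  have hw := contDiffOn_mul_gapMean hf hm hZ hl hr hconst hη hηS
  obtain ⟨c, hc⟩ := (hη.continuous_fderiv one_ne_zero).bounded_above_of_compact_support
    (hηc.fderiv (𝕜 := ℝ))
  set q : ℝ × ℝ → ℝ := fun z => meanSlope f z.1 (gapDist Z z.2) with hq
  have hq0 : ∀ z, 0 ≤ q z := fun z => meanSlope_nonneg hm (gapDist_nonneg hZ (hl _) (hr _))
  have hqm : Measurable q := by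
    have h1 := measurable_gapDist hZ hl hr
    have h2 := hf.measurable
    simp only [hq, meanSlope]
    fun_prop
  have hqLp : MemLp (B.indicator q) (ENNReal.ofReal p) := by
    rw [memLp_indicator_iff_restrict hBm]
    refine ⟨hqm.aestronglyMeasurable, ?_⟩
    rw [eLpNorm_lt_top_iff_lintegral_rpow_enorm_lt_top hp0 ENNReal.ofReal_ne_top,
      ENNReal.toReal_ofReal hp.le]
    refine lt_of_eq_of_lt (lintegral_congr fun z => ?_) hint
    rw [Real.enorm_of_nonneg (hq0 z), ENNReal.ofReal_rpow_of_nonneg (hq0 z) hp.le]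
  have hcLp : ∀ t : ℝ, MemLp (B.indicator fun _ => t) (ENNReal.ofReal p) := fun t =>
    memLp_indicator_const _ hBm t (Or.inr hBv)
  have hbound : ∀ z ∈ Ω, ∀ e : ℝ × ℝ, ‖e‖ ≤ 1 →
      (z ∈ tsupport η → |fderiv ℝ (gapMean f Z) z e| ≤ q z) →
      ‖fderiv ℝ (fun z => η z * gapMean f Z z) z e‖
        ≤ B.indicator (fun _ => M * c) z + B.indicator q z := by
    intro z hz e he hze
    by_cases hzη : z ∈ tsupport η
    · have hd := (contDiffAt_gapMean_and_norm_fderiv_le hf hm hZ hl hr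
        (hconst z hz (hηS hzη).2)).1
      have hu := gapMean_mem_Icc hm hf0 hfM hZ hl hr z
      rw [indicator_of_mem (hηS hzη), indicator_of_mem (hηS hzη),
        fderiv_fun_mul (hη.differentiable one_ne_zero z) (hd.differentiableAt one_ne_zero)]
      have h1 : |fderiv ℝ η z e| ≤ c := by
        refine ((fderiv ℝ η z).le_opNorm e).trans ?_
        exact (mul_le_of_le_one_right (norm_nonneg _) he).trans (hc z)
      have h2 : |gapMean f Z z| ≤ M := by rw [abs_of_nonneg hu.1]; exact hu.2
      simp only [add_apply, smul_apply, smul_eq_mul,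
        Real.norm_eq_abs]
      refine (abs_add_le _ _).trans ?_
      rw [abs_mul, abs_mul, add_comm]
      gcongr
      exact (mul_le_of_le_one_left (abs_nonneg _) (hη1 z)).trans (hze hzη)
    · have h0 : (fun z => η z * gapMean f Z z) =ᶠ[nhds z] fun _ => 0 := by
        filter_upwards [notMem_tsupport_iff_eventuallyEq.1 hzη] with t ht
        simp [ht]
      have hc0 : 0 ≤ c := (norm_nonneg _).trans (hc z)
      rw [h0.fderiv_eq]
      simpa using add_nonneg (indicator_nonneg (fun _ _ => mul_nonneg hM hc0) z)
        (indicator_nonneg (fun z _ => hq0 z) z)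
  have hderiv : ∀ e : ℝ × ℝ, ‖e‖ ≤ 1 →
      (∀ z ∈ Ω ∩ tsupport η, |fderiv ℝ (gapMean f Z) z e| ≤ q z) → MemLp
        (fun z => fderiv ℝ (fun z => η z * gapMean f Z z) z e) (ENNReal.ofReal p)
        (volume.restrict Ω) := by
    intro e he hze
    have hm' : ContinuousOn (fun z => fderiv ℝ (fun z => η z * gapMean f Z z) z e) Ω :=
      (hw.continuousOn_fderiv_of_isOpen hΩ le_rfl).clm_apply continuousOn_const
    refine MemLp.mono' (((hcLp (M * c)).add hqLp).restrict Ω)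
      (hm'.aestronglyMeasurable hΩ.measurableSet)
      ((ae_restrict_iff' hΩ.measurableSet).2 (ae_of_all _ fun z hz => ?_))
    exact hbound z hz e he fun h => hze z ⟨hz, h⟩
  have hgrad := fun z (hz : z ∈ Ω ∩ tsupport η) =>
    (contDiffAt_gapMean_and_norm_fderiv_le hf hm hZ hl hr (hconst z hz.1 (hηS hz.2).2)).2
  refine mem_sobolevW1_of_contDiffOn hΩ hw ?_
    (hderiv (1, 0) (by simp) fun z hz => (hgrad z hz).1)
    (hderiv (0, 1) (by simp) fun z hz => (hgrad z hz).2)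
  refine MemLp.mono' ((hcLp M).restrict Ω)
    (hw.continuousOn.aestronglyMeasurable hΩ.measurableSet) (ae_of_all _ fun z => ?_)
  by_cases hzη : z ∈ tsupport η
  · have hu := gapMean_mem_Icc hm hf0 hfM hZ hl hr z
    rw [indicator_of_mem (hηS hzη), Real.norm_eq_abs, abs_mul, abs_of_nonneg hu.1]
    exact (mul_le_of_le_one_left hu.1 (hη1 z)).trans hu.2
  · rw [image_eq_zero_of_notMem_tsupport hzη, zero_mul, norm_zero]
    exact indicator_nonneg (fun _ _ => hM) z

end CutOff

/-! ### Restriction of weak derivatives to horizontal lines -/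

/-- A horizontal weak derivative on the plane restricts to almost every horizontal line, here for
one test function on the line. It follows from testing with `φ x * ψ y` for arbitrary `ψ`. -/
theorem HasWeakPartialDeriv.ae_integral_line_eq_zero {w g : ℝ × ℝ → ℝ}
    (hg : HasWeakPartialDeriv univ (1, 0) w g) {φ : ℝ → ℝ} (hφ : ContDiff ℝ (⊤ : ℕ∞) φ)
    (hφc : HasCompactSupport φ) :
    ∀ᵐ y, ∫ x, (w (x, y) * deriv φ x + g (x, y) * φ x) = 0 := by
  have hφ' : Continuous (deriv φ) := hφ.continuous_deriv (by simp)
  have hKint : ∀ Q : Set ℝ, IsCompact Q → IntegrableOn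
      (fun z : ℝ × ℝ => w z * deriv φ z.1 + g z * φ z.1) (univ ×ˢ Q) := by
    intro Q hQ
    have hT : IsCompact (tsupport φ ×ˢ Q) := IsCompact.prod hφc hQ
    have hi : IntegrableOn (fun z : ℝ × ℝ => w z * deriv φ z.1 + g z * φ z.1)
        (tsupport φ ×ˢ Q) := by
      refine IntegrableOn.add ?_ ?_
      · exact IntegrableOn.mul_continuousOn
          ((locallyIntegrableOn_univ.1 hg.1).integrableOn_isCompact hT)
          (hφ'.comp continuous_fst).continuousOn hT
      · exact IntegrableOn.mul_continuousOn
          ((locallyIntegrableOn_univ.1 hg.2.1).integrableOn_isCompact hT)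
          (hφ.continuous.comp continuous_fst).continuousOn hT
    refine hi.of_forall_sdiff_eq_zero (MeasurableSet.univ.prod hQ.measurableSet) fun z hz => ?_
    have hz1 : z.1 ∉ tsupport φ := fun h => hz.2 ⟨h, hz.1.2⟩
    rw [image_eq_zero_of_notMem_tsupport hz1,
      image_eq_zero_of_notMem_tsupport fun h => hz1 (tsupport_deriv_subset h)]
    simp
  refine ae_eq_zero_of_integral_contDiff_smul_eq_zero ?_ fun ψ hψ hψc => ?_
  · refine locallyIntegrable_iff.2 fun Q hQ => ?_
    have := hKint Q hQ
    rw [IntegrableOn, Measure.volume_eq_prod, ← Measure.prod_restrict,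
      Measure.restrict_univ] at this
    exact this.integral_prod_right
  have hψ' : ContDiff ℝ (⊤ : ℕ∞) ψ := hψ
  have hΦ : ContDiff ℝ (⊤ : ℕ∞) fun z : ℝ × ℝ => φ z.1 * ψ z.2 :=
    (hφ.comp contDiff_fst).mul (hψ'.comp contDiff_snd)
  have hsub : tsupport (fun z : ℝ × ℝ => φ z.1 * ψ z.2) ⊆ tsupport φ ×ˢ tsupport ψ := by
    refine closure_minimal (fun z hz => ?_)
      ((isClosed_tsupport φ).prod (isClosed_tsupport ψ))
    exact ⟨subset_tsupport _ (left_ne_zero_of_mul hz), subset_tsupport _ (right_ne_zero_of_mul hz)⟩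
  have hΦc : HasCompactSupport fun z : ℝ × ℝ => φ z.1 * ψ z.2 :=
    (IsCompact.prod hφc hψc).of_isClosed_subset (isClosed_tsupport _) hsub
  have hder : ∀ z : ℝ × ℝ, fderiv ℝ (fun z : ℝ × ℝ => φ z.1 * ψ z.2) z (1, 0)
      = deriv φ z.1 * ψ z.2 := by
    rintro ⟨x, y⟩
    have h1 := ((hΦ.differentiable (by simp)) (x, y)).hasFDerivAt.comp_hasDerivAt
      (f := fun t => (t, y)) x ((hasDerivAt_id x).prodMk (hasDerivAt_const x y))
    exact h1.unique (((hφ.differentiable (by simp)) x).hasDerivAt.mul_const (ψ y))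
  have htest := hg.2.2 _ hΦ hΦc (subset_univ _)
  simp only [setIntegral_univ, hder] at htest
  have i1 : Integrable fun z : ℝ × ℝ => w z * (deriv φ z.1 * ψ z.2) := by
    have := (locallyIntegrableOn_univ.1 hg.1).integrable_smul_left_of_hasCompactSupport
      ((hΦ.continuous_fderiv (by simp)).clm_apply (continuous_const (y := ((1 : ℝ), (0 : ℝ)))))
      (hΦc.fderiv_apply (𝕜 := ℝ) (1, 0))
    simpa only [hder, smul_eq_mul, mul_comm] using this
  have i2 : Integrable fun z : ℝ × ℝ => g z * (φ z.1 * ψ z.2) := by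
    have := (locallyIntegrableOn_univ.1 hg.2.1).integrable_smul_left_of_hasCompactSupport
      hΦ.continuous hΦc
    simpa only [smul_eq_mul, mul_comm] using this
  calc ∫ y, ψ y • ∫ x, (w (x, y) * deriv φ x + g (x, y) * φ x)
      = ∫ y, ∫ x, (w (x, y) * (deriv φ x * ψ y) + g (x, y) * (φ x * ψ y)) := by
        congr 1
        ext y
        rw [smul_eq_mul, ← integral_const_mul]
        congr 1
        ext x
        ring
    _ = ∫ z : ℝ × ℝ, (w z * (deriv φ z.1 * ψ z.2) + g z * (φ z.1 * ψ z.2)) :=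
        (integral_prod_symm _ (i1.add i2)).symm
    _ = 0 := by rw [integral_add i1 i2, htest, neg_add_cancel]

/-! ### Non-removability -/

theorem continuous_of_monotone_of_holder {f : ℝ → ℝ} {A s : ℝ} (hm : Monotone f) (hs : 0 < s)
    (hH : ∀ x y, x ≤ y → f y - f x ≤ A * (y - x) ^ s) : Continuous f := by
  refine continuous_iff_continuousAt.2 fun x => ?_
  have hbound : ∀ y, dist (f y) (f x) ≤ A * |y - x| ^ s := by
    intro y
    rcases le_total x y with h | h
    · rw [Real.dist_eq, abs_of_nonneg (sub_nonneg.2 (hm h)), abs_of_nonneg (sub_nonneg.2 h)]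
      exact hH x y h
    · rw [dist_comm, abs_sub_comm, Real.dist_eq, abs_of_nonneg (sub_nonneg.2 (hm h)),
        abs_of_nonneg (sub_nonneg.2 h)]
      exact hH y x h
  have hlim : Filter.Tendsto (fun y => A * |y - x| ^ s) (nhds x) (nhds 0) := by
    have : Continuous fun y : ℝ => A * |y - x| ^ s :=
      continuous_const.mul ((continuous_id.sub continuous_const).abs.rpow_const
        fun _ => Or.inr hs.le)
    simpa [Real.zero_rpow hs.ne'] using this.tendsto x
  exact tendsto_iff_dist_tendsto_zero.2
    (squeeze_zero (fun _ => dist_nonneg) hbound hlim)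

/-- A function equal to `0` left of `-R` and to `M` right of `R` has distributional derivative of
total mass `M`, which a test function equal to `1` on `[-R, R]` detects. -/
theorem integral_mul_deriv_eq_neg {f φ : ℝ → ℝ} {R M : ℝ}
    (hfl : ∀ x < -R, f x = 0) (hfr : ∀ x, R ≤ x → f x = M) (hφ : ContDiff ℝ 1 φ)
    (hφc : HasCompactSupport φ) (hφR : φ R = 1) (hφ' : ∀ x ∈ Icc (-R) R, deriv φ x = 0) :
    ∫ x, f x * deriv φ x = -M := by
  have h : (fun x => f x * deriv φ x) = (Ioi R).indicator fun x => M * deriv φ x := by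
    ext x
    by_cases hx : x ∈ Ioi R
    · rw [indicator_of_mem hx, hfr x (le_of_lt hx)]
    · rw [indicator_of_notMem hx]
      rcases lt_or_ge x (-R) with h | h
      · rw [hfl x h, zero_mul]
      · rw [hφ' x ⟨h, not_lt.1 hx⟩, mul_zero]
  rw [h, integral_indicator measurableSet_Ioi, integral_const_mul,
    hφc.integral_Ioi_deriv_eq hφ, hφR]
  ring

theorem mainTheorem1 (p s : ℝ) (hp : 2 ≤ p) (hs : (p - 2) / (p - 1) < s)
    (C : Set ℝ) (hC : IsClosed C) (hCs : 0 < Measure.hausdorffMeasure s C)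
    (a b : ℕ → ℝ) (hab : ∀ j, a j ≤ b j)
    (hsum : Summable fun j => (b j - a j) ^ (1 - (1 - s) * (p - 1)))
    (F : Set ℝ) (hF : F = Icc 0 1 \ ⋃ j, Ioo (a j) (b j))
    (hF1 : 0 < Measure.hausdorffMeasure 1 F) :
    ¬ IsSobolevRemovable (ENNReal.ofReal p) (C ×ˢ F) := by
  rintro ⟨hnull, heq⟩
  have hs0 : 0 < s := (div_nonneg (by linarith) (by linarith)).trans_lt hs
  have hs1 : s ≤ 1 := le_one_of_pos_hausdorffMeasure_real hCs
  have hαeq : 1 - (1 - s) * (p - 1) = (s - 1) * (p - 1) + 1 := by ring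
  have hα : 0 < (s - 1) * (p - 1) + 1 := by
    rw [div_lt_iff₀ (by linarith)] at hs
    linarith
  rw [hαeq] at hsum
  obtain ⟨f, R, M, A, hR, hM, hA, hm, hfl, hfr, hH, hfC⟩ := exists_holder_cantor_function hs0 hC hCs
  have hf : Continuous f := continuous_of_monotone_of_holder hm hs0 hH
  have hf0 : ∀ x, 0 ≤ f x := fun x => by
    rw [← hfl (min x (-R - 1)) ((min_le_right _ _).trans_lt (by linarith))]
    exact hm (min_le_left _ _)
  have hfM : ∀ x, f x ≤ M := fun x => by
    rw [← hfr (max x R) (le_max_right _ _)]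
    exact hm (le_max_left _ _)
  -- `Z` agrees with `F` in the strip `-1 < y < 2`, and has points on both sides of every point
  have hFc : IsClosed F := by
    rw [hF]
    exact isClosed_Icc.sdiff (isOpen_iUnion fun j => isOpen_Ioo)
  set Z : Set ℝ := F ∪ (Iic (-1) ∪ Ici 2) with hZdef
  have hZ : IsClosed Z := hFc.union (isClosed_Iic.union isClosed_Ici)
  have hl : ∀ y, (Z ∩ Iic y).Nonempty := fun y =>
    ⟨min y (-1), Or.inr (Or.inl (mem_Iic.2 (min_le_right _ _))), mem_Iic.2 (min_le_left _ _)⟩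
  have hr : ∀ y, (Z ∩ Ici y).Nonempty := fun y =>
    ⟨max y 2, Or.inr (Or.inr (mem_Ici.2 (le_max_right _ _))), mem_Ici.2 (le_max_left _ _)⟩
  have hZF : ∀ y ∈ Ioo (-1 : ℝ) 2, y ∈ Z → y ∈ F := fun y hy hyZ =>
    hyZ.resolve_right fun h => h.elim (fun h => hy.1.not_ge h) fun h => hy.2.not_ge h
  have hF01 : F ⊆ Icc 0 1 := by rw [hF]; exact sdiff_subset
  -- the gaps of `F` in the strip: the given intervals, and one on either side of `[0, 1]`
  have hint : ∫⁻ z in Icc (-(R + 4)) (R + 4) ×ˢ Ioo (-1) 2,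
      ENNReal.ofReal (meanSlope f z.1 (gapDist Z z.2) ^ p) < ⊤ := by
    let a' : ℕ → ℝ := fun | 0 => -1 | 1 => 1 | j + 2 => max (a j) (-1)
    let b' : ℕ → ℝ := fun | 0 => 0 | 1 => 2 | j + 2 => min (b j) 2
    let ℓ : ℕ → ℝ := fun | 0 => 1 | 1 => 1 | j + 2 => b j - a j
    have hZlt : ∀ y ∈ Ioo (-1 : ℝ) 2, (y < 0 ∨ 1 < y ∨ ∃ j, y ∈ Ioo (a j) (b j)) → y ∉ Z := by
      intro y hy h hyZ
      have hyF := hZF y hy hyZ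
      rcases h with h | h | h
      · exact h.not_ge (hF01 hyF).1
      · exact h.not_ge (hF01 hyF).2
      · rw [hF] at hyF
        exact hyF.2 (mem_iUnion.2 h)
    refine lintegral_meanSlope_gapDist_lt_top (a := a') (b := b') (ℓ := ℓ) hf hm hZ hl hr hf0 hfM
      hA hH (by linarith) (by linarith) hs1 hα ?_ ?_ ?_ ?_
    · rintro y ⟨hy, hyZ⟩
      rcases lt_or_ge y 0 with h0 | h0
      · exact mem_iUnion.2 ⟨0, hy.1, h0⟩
      rcases lt_or_ge 1 y with h1 | h1
      · exact mem_iUnion.2 ⟨1, h1, hy.2⟩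
      have : y ∈ ⋃ j, Ioo (a j) (b j) := by
        by_contra h
        exact hyZ (Or.inl (hF ▸ ⟨⟨h0, h1⟩, h⟩))
      obtain ⟨j, hj⟩ := mem_iUnion.1 this
      exact mem_iUnion.2 ⟨j + 2, max_lt hj.1 hy.1, lt_min hj.2 hy.2⟩
    · rintro (_ | _ | j)
      · exact disjoint_left.2 fun y hy => hZlt y
          ⟨hy.1, lt_trans (show y < 0 from hy.2) two_pos⟩ (Or.inl hy.2)
      · exact disjoint_left.2 fun y hy => hZlt y
          ⟨lt_trans (by norm_num) (show 1 < y from hy.1), hy.2⟩ (Or.inr (Or.inl hy.1))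
      · exact disjoint_left.2 fun y hy => hZlt y
          ⟨(max_lt_iff.1 hy.1).2, (lt_min_iff.1 hy.2).2⟩
          (Or.inr (Or.inr ⟨j, (max_lt_iff.1 hy.1).1, (lt_min_iff.1 hy.2).1⟩))
    · rintro (_ | _ | j)
      · norm_num [a', b', ℓ]
      · norm_num [a', b', ℓ]
      · exact sub_le_sub (min_le_left _ _) (le_max_left _ _)
    · exact (summable_nat_add_iff 2).1 hsum
  -- a test function `φ`, and cutoffs equal to `1` near its support and near `[0, 1]`
  let φ : ContDiffBump (0 : ℝ) := ⟨R + 1, R + 2, by linarith, by linarith⟩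
  let η₁ : ContDiffBump (0 : ℝ) := ⟨R + 3, R + 4, by linarith, by linarith⟩
  let η₂ : ContDiffBump (1 / 2 : ℝ) := ⟨1 / 2, 1, by norm_num, by norm_num⟩
  let η : ℝ × ℝ → ℝ := fun z => η₁ z.1 * η₂ z.2
  have hη : ContDiff ℝ 1 η := (η₁.contDiff.comp contDiff_fst).mul (η₂.contDiff.comp contDiff_snd)
  have hηs : tsupport η ⊆ Metric.closedBall 0 (R + 4) ×ˢ Metric.closedBall (1 / 2) 1 := by
    refine closure_minimal (fun z hz => ⟨?_, ?_⟩)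
      (Metric.isClosed_closedBall.prod Metric.isClosed_closedBall)
    · exact Metric.ball_subset_closedBall (η₁.support_eq ▸ left_ne_zero_of_mul hz)
    · exact Metric.ball_subset_closedBall (η₂.support_eq ▸ right_ne_zero_of_mul hz)
  have hηc : HasCompactSupport η :=
    (IsCompact.prod (isCompact_closedBall _ _) (isCompact_closedBall _ _)).of_isClosed_subset
      (isClosed_tsupport _) hηs
  have hηS : tsupport η ⊆ Icc (-(R + 4)) (R + 4) ×ˢ Ioo (-1) 2 := by
    refine hηs.trans (prod_mono ?_ ?_)
    · rw [Real.closedBall_eq_Icc]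
      simp
    · rw [Real.closedBall_eq_Icc]
      exact Icc_subset_Ioo (by norm_num) (by norm_num)
  have hη1 : ∀ z, |η z| ≤ 1 := fun z => by
    rw [abs_of_nonneg (mul_nonneg η₁.nonneg η₂.nonneg)]
    exact mul_le_one₀ η₁.le_one η₂.nonneg η₂.le_one
  have hη₂F : ∀ y ∈ F, η₂ y = 1 := fun y hy => η₂.one_of_mem_closedBall <| by
    rw [Real.closedBall_eq_Icc]
    have := hF01 hy
    constructor <;> norm_num [η₂] <;> linarith [this.1, this.2]
  have hη₁φ : ∀ x ∈ tsupport φ, η₁ =ᶠ[nhds x] fun _ => 1 := fun x hx => by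
    rw [φ.tsupport_eq, Metric.mem_closedBall, dist_zero_right] at hx
    have : x ∈ Metric.ball (0 : ℝ) (R + 3) := by
      rw [Metric.mem_ball, dist_zero_right]
      exact lt_of_le_of_lt hx (show R + 2 < R + 3 by linarith)
    filter_upwards [Metric.isOpen_ball.mem_nhds this] with t ht
      using η₁.one_of_mem_closedBall (Metric.ball_subset_closedBall ht)
  set Ω : Set (ℝ × ℝ) := (C ×ˢ F)ᶜ
  have hΩ : IsOpen Ω := (hC.prod hFc).isOpen_compl
  have hconst : ∀ z ∈ Ω, z.2 ∈ Ioo (-1 : ℝ) 2 → z.2 ∈ Z →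
      ∃ ε > 0, ∀ x, |x - z.1| < ε → f x = f z.1 := fun z hz hz2 hzZ =>
    hfC z.1 fun hzC => hz ⟨hzC, hZF _ hz2 hzZ⟩
  have hw := contDiffOn_mul_gapMean hf hm hZ hl hr hconst hη hηS
  have hwΩ := mul_gapMean_mem_sobolevW1 hf hm hf0 hfM hZ hl hr hΩ hconst hη hηc hη1
    measurableSet_Ioo (by simp) hηS (by linarith) hint
  rw [heq] at hwΩ
  set w : ℝ × ℝ → ℝ := fun z => η z * gapMean f Z z with hwdef
  obtain ⟨-, ⟨g, -, hg⟩, -⟩ := hwΩ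
  -- the weak derivative `g` on the plane is the classical derivative of `w` almost everywhere
  have hgΩ : ∀ᵐ z, g z = fderiv ℝ w z (1, 0) := by
    have hmem : ∀ᵐ z, z ∈ Ω := compl_mem_ae_iff.2 hnull
    filter_upwards [hg.ae_eq_fderiv hΩ hw, hmem] with z h1 h2 using h1 h2
  have hF0 : volume F ≠ 0 := by
    rw [hausdorffMeasure_real] at hF1
    exact hF1.ne'
  have hC0 : volume C = 0 := by
    rw [Measure.volume_eq_prod, Measure.prod_prod] at hnull
    exact (mul_eq_zero.1 hnull).resolve_right hF0
  have hline := hg.ae_integral_line_eq_zero φ.contDiff φ.hasCompactSupport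
  have hgline : ∀ᵐ y, ∀ᵐ x, g (x, y) = fderiv ℝ w (x, y) (1, 0) := by
    rw [Measure.volume_eq_prod] at hgΩ
    have := Measure.measurePreserving_swap.quasiMeasurePreserving.ae hgΩ
    exact Measure.ae_ae_of_ae_prod this
  obtain ⟨y, hyF, hy1, hy2⟩ : ∃ y ∈ F, (∫ x, (w (x, y) * deriv φ x + g (x, y) * φ x) = 0) ∧
      ∀ᵐ x, g (x, y) = fderiv ℝ w (x, y) (1, 0) := by
    by_contra h
    refine hF0 (measure_mono_null (fun y hy => ?_) (hline.and hgline))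
    exact fun hh => h ⟨y, hy, hh.1, hh.2⟩
  have hyZ : y ∈ Z := Or.inl hyF
  -- on the line at height `y ∈ F` the classical derivative vanishes off the null set `C`
  have hgφ : ∀ᵐ x, w (x, y) * deriv φ x + g (x, y) * φ x = f x * deriv φ x := by
    filter_upwards [hy2, compl_mem_ae_iff.2 hC0] with x hx hxC
    by_cases hxφ : x ∈ tsupport φ
    · have hd := (hw.differentiableOn one_ne_zero).differentiableAt
        (hΩ.mem_nhds (show (x, y) ∈ Ω from fun h => hxC h.1))
      have h1 := hd.hasFDerivAt.comp_hasDerivAt (f := fun t => (t, y)) x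
        ((hasDerivAt_id x).prodMk (hasDerivAt_const x y))
      have hval : (w ∘ fun t => (t, y)) =ᶠ[nhds x] f := by
        filter_upwards [hη₁φ x hxφ] with t ht
        simp only [Function.comp, hwdef, η, ht, hη₂F y hyF,
          gapMean_of_mem (f := f) (z := (t, y)) hyZ, one_mul]
      have hfx : f =ᶠ[nhds x] fun _ => f x := by
        obtain ⟨ε, hε, h⟩ := hfC x hxC
        filter_upwards [Metric.ball_mem_nhds x hε] with t ht using h t ht
      have h2 : fderiv ℝ w (x, y) (1, 0) = 0 :=
        h1.unique ((hasDerivAt_const x (f x)).congr_of_eventuallyEq (hval.trans hfx))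
      rw [hx, h2, zero_mul, add_zero, show w (x, y) = f x from hval.eq_of_nhds]
    · rw [image_eq_zero_of_notMem_tsupport hxφ,
        image_eq_zero_of_notMem_tsupport fun h => hxφ (tsupport_deriv_subset h)]
      simp
  rw [integral_congr_ae hgφ,
    integral_mul_deriv_eq_neg hfl hfr φ.contDiff φ.hasCompactSupport] at hy1
  · linarith
  · refine φ.one_of_mem_closedBall ?_
    rw [Metric.mem_closedBall, dist_zero_right, Real.norm_of_nonneg hR]
    exact show R ≤ R + 1 by linarith
  · intro x hx
    have : x ∈ Metric.ball (0 : ℝ) (R + 1) := by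
      rw [Metric.mem_ball, dist_zero_right, Real.norm_eq_abs, abs_lt]
      constructor <;> linarith [hx.1, hx.2]
    have h : φ =ᶠ[nhds x] fun _ => 1 := by
      filter_upwards [Metric.isOpen_ball.mem_nhds this] with t ht
        using φ.one_of_mem_closedBall (Metric.ball_subset_closedBall ht)
    rw [h.deriv_eq, deriv_const]
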